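/- Let $K\ge 1$, let $X_1,\dots,X_K$ be compact metric spaces with Borel probability measures $\mu_1,\dots,\mu_K$, and let $c:X_1\times\cdots\times X_K\to[0,\infty)$ be continuous. Put $$\mathsf{MOT}_c(\mu_1,\dots,\mu_K)=\inf_{\pi}\int c\,d\pi ,$$ where $\pi$ runs over the Borel probability measures on $X_1\times\cdots\times X_K$ with marginals $\mu_1,\dots,\mu_K$. For a family $\boldsymbol f=(f_1,\dots,f_K)$ of functions $f_k:X_k\to\mathbb R$ put $J(\boldsymbol f)=\sum_{k=1}^K\int_{X_k} f_k\,d\mu_k$, and let $\mathcal F_c$ be the set of all families such that every $f_k$ is Borel and $\mu_k$-integrable and $\sum_{k=1}^K f_k(x_k)\le c(x_1,\dots,x_K)$ for all $(x_1,\dots,x_K)$. The dual problem is to maximize $J$ over $\mathcal F_c$. The $c$-conjugate of a family $\boldsymbol f$ in the $k$-th variable is $$f_k^c(x_k)=\inf_{(x_l)_{l\ne k}}\Big\{c(x_1,\dots,x_K)-\sum_{l\ne k}f_l(x_l)\Big\}\in[-\infty,\infty),\qquad x_k\in X_k .$$ Let $c\text{-conj}(X_k)$ be the set of functions $g:X_k\to\mathbb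 R$ that equal $f_k^c$ for some family $\boldsymbol f$ of real-valued functions, and call a family $\boldsymbol f$ of real-valued functions $c$-conjugate if $f_k=f_k^c$ for every $k=1,\dots,K$. Then the dual problem has a solution $\boldsymbol f\in\mathcal F_c$ that is a $c$-conjugate family; in particular $f_k\in c\text{-conj}(X_k)$ for every $k$. Moreover every $c$-conjugate family belongs to $\mathcal F_c$, and $$\mathsf{MOT}_c(\mu_1,\dots,\mu_K)=\max_{\boldsymbol f\in\mathcal F_c}J(\boldsymbol f)=\max_{\boldsymbol f\in\mathcal F_c\cap\prod_{k=1}^K c\text{-conj}(X_k)}J(\boldsymbol f)=\max_{\boldsymbol f\ c\text{-conjugate family}}J(\boldsymbol f),$$ all the maxima being attained. -/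

import Mathlib

open MeasureTheory

noncomputable section

namespace MOT

variable {K : ℕ} {X : Fin K → Type*}

/-- The `c`-conjugate of the family `f` in the `k`-th variable, evaluated at `x : X k`: the infimum of
`c y - ∑_{l ≠ k} f l (y l)` over all points `y` of the product whose `k`-th coordinate is `x`.
The infimum is taken in the extended reals, since it may be `-∞` for an arbitrary family. -/
def cConjugate (c : (∀ i, X i) → ℝ) (f : ∀ i, X i → ℝ) (k : Fin K) (x : X k) : EReal :=
  ⨅ (y : ∀ i, X i) (_ : y k = x), ((c y - ∑ l ∈ Finset.univ.erase k, f l (y l) : ℝ) : EReal)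

/-- The set `c-conj(X_k)` of real-valued functions on `X k` that are the `c`-conjugate in the `k`-th
variable of some family of real-valued functions (whose `k`-th member plays no role). -/
def cConj (c : (∀ i, X i) → ℝ) (k : Fin K) : Set (X k → ℝ) :=
  {g | ∃ f : ∀ i, X i → ℝ, ∀ x, (g x : EReal) = cConjugate c f k x}

/-- The families all of whose components have the form `c-conj(X_k)`, the conjugating functions being
allowed to differ from one component to another. -/
def cConjProd (c : (∀ i, X i) → ℝ) : Set (∀ i, X i → ℝ) :=
  {f | ∀ k, f k ∈ cConj c k}

/-- The `c`-conjugate families: every component is the `c`-conjugate of the others. -/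
def cConjFamilies (c : (∀ i, X i) → ℝ) : Set (∀ i, X i → ℝ) :=
  {f | ∀ k x, (f k x : EReal) = cConjugate c f k x}

variable [∀ i, MeasurableSpace (X i)]

/-- The transport plans: probability measures on the product with marginals `μ k`. -/
def plans (μ : ∀ i, Measure (X i)) : Set (Measure (∀ i, X i)) :=
  {π | IsProbabilityMeasure π ∧ ∀ k, π.map (fun x => x k) = μ k}

/-- The total cost of a plan. -/
def primalCost (c : (∀ i, X i) → ℝ) (π : Measure (∀ i, X i)) : ℝ :=
  ∫ x, c x ∂π

/-- The multimarginal optimal transport value. -/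
def motValue (c : (∀ i, X i) → ℝ) (μ : ∀ i, Measure (X i)) : ℝ :=
  sInf (primalCost c '' plans μ)

/-- The dual functional. -/
def dualValue (μ : ∀ i, Measure (X i)) (f : ∀ i, X i → ℝ) : ℝ :=
  ∑ k, ∫ x, f k x ∂(μ k)

/-- The admissible class of the dual problem. -/
def admissible (c : (∀ i, X i) → ℝ) (μ : ∀ i, Measure (X i)) : Set (∀ i, X i → ℝ) :=
  {f | (∀ k, Measurable (f k) ∧ Integrable (f k) (μ k)) ∧ ∀ x : ∀ i, X i, ∑ k, f k (x k) ≤ c x}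

/-- The solutions of the dual problem: admissible families maximizing the dual functional. -/
def dualSolutions (c : (∀ i, X i) → ℝ) (μ : ∀ i, Measure (X i)) : Set (∀ i, X i → ℝ) :=
  {f | f ∈ admissible c μ ∧ ∀ g ∈ admissible c μ, dualValue μ g ≤ dualValue μ f}

end MOT

end

/-! Integrating the constraint against a plan gives `J ≤ MOT`. For equality, let `p = superhedge μ`,
a sublinear functional on continuous functions. By Hahn–Banach some linear `L ≤ p` has `L (-c) = p
(-c)`. Domination makes `L` positive with marginals `μ k`, so by Riesz it is a plan, of cost `-p
(-c)`, the supremum of `J` over continuous feasible families. This supremum is attained at a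
conjugate family: conjugating coordinate by coordinate raises `J`, and conjugates inherit the moduli
of continuity of `c`. After normalization by constants they are bounded, so Arzelà–Ascoli applies
(`exists_cConjFamilies_max`). Weak duality then extends optimality from continuous to all admissible
families. -/

namespace MOT

/-! ### Algebra of `c`-conjugates. -/

section Conjugate

variable {K : ℕ} {X : Fin K → Type*} {c : (∀ i, X i) → ℝ} {f g : ∀ i, X i → ℝ} {k : Fin K}

/-- Lets later arguments use real lower bounds in place of `EReal` infima. -/
lemma coe_eq_cConjugate_iff {a : ℝ} {x : X k} :
    (a : EReal) = cConjugate c f k x ↔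
      (∀ y : ∀ i, X i, y k = x → a ≤ c y - ∑ l ∈ Finset.univ.erase k, f l (y l)) ∧
      ∀ b : ℝ, (∀ y : ∀ i, X i, y k = x → b ≤ c y - ∑ l ∈ Finset.univ.erase k, f l (y l)) →
        b ≤ a := by
  constructor
  · intro h
    refine ⟨fun y hy => ?_, fun b hb => ?_⟩
    · have : (a : EReal) ≤ _ := h.le.trans (iInf₂_le y hy)
      exact_mod_cast this
    · have : (b : EReal) ≤ a := h ▸ le_iInf₂ fun y hy => by exact_mod_cast hb y hy
      exact_mod_cast this
  · rintro ⟨h₁, h₂⟩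
    refine le_antisymm (le_iInf₂ fun y hy => by exact_mod_cast h₁ y hy) ?_
    refine le_of_forall_lt fun b hb => ?_
    obtain ⟨q, hbq, hq⟩ := EReal.lt_iff_exists_real_btwn.1 hb
    refine hbq.trans_le (EReal.coe_le_coe_iff.2 (h₂ q fun y hy => ?_))
    have : (q : EReal) ≤ _ := hq.le.trans (iInf₂_le y hy)
    exact_mod_cast this

lemma sum_erase_update (y : ∀ i, X i) (x : X k) :
    ∑ l ∈ Finset.univ.erase k, f l (Function.update y k x l) =
      ∑ l ∈ Finset.univ.erase k, f l (y l) :=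
  Finset.sum_congr rfl fun l hl => by
    rw [Function.update_of_ne (Finset.ne_of_mem_erase hl)]

/-- A family with a conjugate component satisfies the constraint of the dual problem. -/
lemma sum_le_of_conjugate (h : ∀ x, (f k x : EReal) = cConjugate c f k x) (x : ∀ i, X i) :
    ∑ i, f i (x i) ≤ c x := by
  have := (coe_eq_cConjugate_iff.1 (h (x k))).1 x rfl
  rw [← Finset.add_sum_erase _ _ (Finset.mem_univ k)]
  linarith

/-- A conjugate function inherits every modulus of continuity of the cost in its variable. -/
lemma conjugate_le_add (h : ∀ x, (g k x : EReal) = cConjugate c f k x) {x x' : X k} {B : ℝ}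
    (hB : ∀ y : ∀ i, X i, c (Function.update y k x) ≤ c (Function.update y k x') + B) :
    g k x ≤ g k x' + B := by
  suffices g k x - B ≤ g k x' by linarith
  refine (coe_eq_cConjugate_iff.1 (h x')).2 _ fun y hy => ?_
  -- Moving the `k`-th coordinate of `y` to `x` leaves the sum over `l ≠ k` unchanged and raises the
  -- cost by at most `B`.
  have h₁ := (coe_eq_cConjugate_iff.1 (h x)).1 (Function.update y k x) (by simp)
  rw [sum_erase_update] at h₁
  have h₂ := hB y
  rw [← hy, Function.update_eq_self] at h₂
  linarith

/-- Replacing one component of a feasible family by its conjugate increases it. -/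
lemma exists_conjugate (hf : ∀ x : ∀ i, X i, ∑ i, f i (x i) ≤ c x)
    [∀ i, Nonempty (X i)] (k : Fin K) :
    ∃ u : X k → ℝ, (∀ x, (u x : EReal) = cConjugate c f k x) ∧ ∀ x, f k x ≤ u x := by
  classical
  set F : (∀ i, X i) → ℝ := fun y => c y - ∑ l ∈ Finset.univ.erase k, f l (y l)
  have hF : ∀ y, f k (y k) ≤ F y := fun y => by
    have := hf y
    rw [← Finset.add_sum_erase _ _ (Finset.mem_univ k)] at this
    simp only [F]; linarith
  have hne : ∀ x : X k, (F '' {y | y k = x}).Nonempty := fun x =>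
    ⟨_, Function.update (fun i => Classical.arbitrary (X i)) k x, by simp, rfl⟩
  have hlb : ∀ x : X k, f k x ∈ lowerBounds (F '' {y | y k = x}) := by
    rintro x _ ⟨y, rfl, rfl⟩
    exact hF y
  refine ⟨fun x => sInf (F '' {y | y k = x}), fun x => coe_eq_cConjugate_iff.2 ⟨?_, ?_⟩,
    fun x => le_csInf (hne x) (hlb x)⟩
  · exact fun y hy => csInf_le ⟨_, hlb x⟩ ⟨y, hy, rfl⟩
  · rintro b hb
    refine le_csInf (hne x) ?_
    rintro _ ⟨y, hy, rfl⟩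
    exact hb y hy

/-- Increasing the other components of a feasible family preserves a conjugate component. -/
lemma conjugate_of_le (h : ∀ x, (f k x : EReal) = cConjugate c f k x) (hk : g k = f k)
    (hle : ∀ i x, f i x ≤ g i x) (hg : ∀ x : ∀ i, X i, ∑ i, g i (x i) ≤ c x) (x : X k) :
    (g k x : EReal) = cConjugate c g k x := by
  -- Feasibility makes `g k` a lower bound; raising the other components can only lower the
  -- conjugate.
  refine coe_eq_cConjugate_iff.2 ⟨?_, fun b hb => ?_⟩
  · rintro y rfl
    have := hg y
    rw [← Finset.add_sum_erase _ _ (Finset.mem_univ k)] at this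
    linarith
  · rw [hk]
    refine (coe_eq_cConjugate_iff.1 (h x)).2 b fun y hy => (hb y hy).trans ?_
    have := Finset.sum_le_sum (s := Finset.univ.erase k) fun i _ => hle i (y i)
    linarith

/-- Adding constants of total zero to a conjugate family makes it bounded in terms of the cost. -/
lemma exists_normalization (hK : 1 ≤ K) [∀ i, Nonempty (X i)] {M : ℝ}
    (hc0 : ∀ x, 0 ≤ c x) (hM : ∀ x, c x ≤ M) (hf : f ∈ cConjFamilies c) :
    ∃ a : Fin K → ℝ, ∑ k, a k = 0 ∧ ∀ k x, |f k x + a k| ≤ 2 * M := by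
  have hM0 : 0 ≤ M := (hc0 fun i => Classical.arbitrary (X i)).trans (hM _)
  have hosc : ∀ k x x', f k x ≤ f k x' + M := fun k x x' =>
    conjugate_le_add (hf k) fun y => by
      linarith [hM (Function.update y k x), hc0 (Function.update y k x')]
  set z : ∀ i, X i := fun i => Classical.arbitrary (X i)
  set t := ∑ k, f k (z k) with ht
  have hKpos : (1 : ℝ) ≤ K := by exact_mod_cast hK
  have htM : t ≤ M := (sum_le_of_conjugate (hf ⟨0, hK⟩) z).trans (hM z)
  -- The conjugate at `z k` is an infimum over `y`; since `c ≥ 0` and each of the `K - 1` other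
  -- components oscillates by at most `M`, the bound follows.
  have htM' : -(K * M) ≤ t := by
    set k : Fin K := ⟨0, hK⟩
    have h₁ : ∀ y : ∀ i, X i, y k = z k → -(K * M) - ∑ l ∈ Finset.univ.erase k, f l (z l) ≤
        c y - ∑ l ∈ Finset.univ.erase k, f l (y l) := fun y hy => by
      have h₂ : ∑ l ∈ Finset.univ.erase k, f l (y l) ≤
          ∑ l ∈ Finset.univ.erase k, f l (z l) + (K - 1 : ℕ) * M := by
        refine (Finset.sum_le_sum fun i _ => hosc i (y i) (z i)).trans ?_
        simp [Finset.sum_add_distrib, Finset.card_erase_of_mem]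
      rw [Nat.cast_sub hK] at h₂
      push_cast at h₂
      nlinarith [hc0 y]
    have h₃ := (coe_eq_cConjugate_iff.1 (hf k (z k))).2 _ h₁
    rw [ht, ← Finset.add_sum_erase _ _ (Finset.mem_univ k)]
    linarith
  have hK0 : (0 : ℝ) < K := by linarith
  have hq : |t / K| ≤ M := by
    rw [abs_le]
    constructor
    · rw [le_div_iff₀ hK0]; linarith
    · rw [div_le_iff₀ hK0]; nlinarith
  -- Every shifted component equals `t / K` at `z k`, of size at most `M`; oscillation adds another
  -- `M`.
  refine ⟨fun k => t / K - f k (z k), ?_, fun k x => ?_⟩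
  · rw [Finset.sum_sub_distrib, ← ht]
    simp only [Finset.sum_const, Finset.card_univ, Fintype.card_fin, nsmul_eq_mul]
    field_simp; ring
  · have h₁ := hosc k x (z k)
    have h₂ := hosc k (z k) x
    rw [abs_le] at hq ⊢
    constructor <;> linarith

end Conjugate

/-! ### Continuity of conjugates and iterated conjugation. -/

section Compact

variable {K : ℕ} {X : Fin K → Type*} [∀ k, MetricSpace (X k)] [∀ k, CompactSpace (X k)]
  {c : (∀ i, X i) → ℝ} {f g : ∀ i, X i → ℝ}

lemma exists_uniform_modulus (hc : Continuous c) {ε : ℝ} (hε : 0 < ε) :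
    ∃ δ > 0, ∀ (k : Fin K) (x x' : X k), dist x x' < δ → ∀ y : ∀ i, X i,
      c (Function.update y k x) ≤ c (Function.update y k x') + ε := by
  obtain ⟨δ, hδ, h⟩ := Metric.uniformContinuous_iff.1
    (CompactSpace.uniformContinuous_of_continuous hc) ε hε
  refine ⟨δ, hδ, fun k x x' hx y => ?_⟩
  have hd : dist (Function.update y k x) (Function.update y k x') < δ := by
    refine (dist_pi_lt_iff hδ).2 fun i => ?_
    by_cases hi : i = k
    · subst hi; simpa using hx
    · simpa [hi] using hδ
  have := h hd
  rw [Real.dist_eq, abs_lt] at this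
  linarith

lemma exists_cost_bound (hc : Continuous c) : ∃ M, ∀ x, c x ≤ M := by
  obtain ⟨M, hM⟩ := (isCompact_range hc).bddAbove
  exact ⟨M, fun x => hM ⟨x, rfl⟩⟩

lemma continuous_of_conjugate (hc : Continuous c) {k : Fin K}
    (h : ∀ x, (g k x : EReal) = cConjugate c f k x) : Continuous (g k) := by
  refine Metric.continuous_iff.2 fun x ε hε => ?_
  obtain ⟨δ, hδ, hm⟩ := exists_uniform_modulus hc (half_pos hε)
  refine ⟨δ, hδ, fun x' hx' => ?_⟩
  have h₁ := conjugate_le_add h (hm k x' x hx')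
  have h₂ := conjugate_le_add h (hm k x x' (by rwa [dist_comm]))
  rw [Real.dist_eq, abs_lt]
  constructor <;> linarith

/-- Every continuous feasible family is dominated by a conjugate family. -/
lemma exists_cConjFamilies_ge [∀ i, Nonempty (X i)] (hc : Continuous c)
    (hf : ∀ k, Continuous (f k)) (hfc : ∀ x : ∀ i, X i, ∑ i, f i (x i) ≤ c x) :
    ∃ g ∈ cConjFamilies c, ∀ k x, f k x ≤ g k x := by
  -- `s` collects the coordinates already conjugated; they stay conjugate by `conjugate_of_le`.
  suffices H : ∀ s : Finset (Fin K), ∃ g : ∀ i, X i → ℝ, (∀ k, Continuous (g k)) ∧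
      (∀ x : ∀ i, X i, ∑ i, g i (x i) ≤ c x) ∧ (∀ k x, f k x ≤ g k x) ∧
      ∀ k ∈ s, ∀ x, (g k x : EReal) = cConjugate c g k x by
    obtain ⟨g, -, -, hge, hg⟩ := H Finset.univ
    exact ⟨g, fun k x => hg k (Finset.mem_univ k) x, hge⟩
  intro s
  induction s using Finset.induction_on with
  | empty => exact ⟨f, hf, hfc, fun _ _ => le_rfl, by simp⟩
  | insert k s _ ih =>
    obtain ⟨g, hgc, hgf, hge, hgs⟩ := ih
    obtain ⟨u, hu, hgu⟩ := exists_conjugate hgf k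
    set g' := Function.update g k u with hg'
    have hk : g' k = u := by simp [hg']
    have hne : ∀ i, i ≠ k → g' i = g i := fun i hi => by simp [hg', hi]
    have hle : ∀ i x, g i x ≤ g' i x := fun i x => by
      by_cases hi : i = k
      · subst hi; rw [hk]; exact hgu x
      · rw [hne i hi]
    have hconj : ∀ x, (g' k x : EReal) = cConjugate c g' k x := fun x => by
      rw [hk, hu]
      unfold cConjugate
      refine iInf_congr fun y => iInf_congr fun _ => ?_
      rw [Finset.sum_congr rfl fun l hl => by rw [← hne l (Finset.ne_of_mem_erase hl)]]
    have hsum := sum_le_of_conjugate hconj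
    refine ⟨g', fun i => ?_, hsum, fun i x => (hge i x).trans (hle i x), fun i hi => ?_⟩
    · by_cases hi : i = k
      · subst hi; exact continuous_of_conjugate hc hconj
      · rw [hne i hi]; exact hgc i
    · by_cases hik : i = k
      · subst hik; exact hconj
      · exact conjugate_of_le (hgs i (Finset.mem_of_mem_insert_of_ne hi hik)) (hne i hik) hle hsum

end Compact

/-! ### Weak duality and existence of a maximizer. -/

section Measure

variable {K : ℕ} {X : Fin K → Type*} [∀ k, MeasurableSpace (X k)]
  {μ : ∀ k, Measure (X k)} {c : (∀ i, X i) → ℝ}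

lemma integrable_sum_and_integral_eq {π : Measure (∀ i, X i)} (hπ : π ∈ plans μ)
    {f : ∀ i, X i → ℝ} (hf : ∀ k, Integrable (f k) (μ k)) :
    Integrable (fun x => ∑ k, f k (x k)) π ∧ ∫ x, ∑ k, f k (x k) ∂π = dualValue μ f := by
  have hm : ∀ k, MeasurePreserving (fun x : ∀ i, X i => x k) π (μ k) := fun k =>
    ⟨measurable_pi_apply k, hπ.2 k⟩
  have hi : ∀ k, Integrable (fun x : ∀ i, X i => f k (x k)) π := fun k =>
    (hm k).integrable_comp_of_integrable (hf k)
  refine ⟨integrable_finsetSum _ fun k _ => hi k, ?_⟩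
  rw [integral_finsetSum _ fun k _ => hi k]
  refine Finset.sum_congr rfl fun k _ => ?_
  rw [← hπ.2 k]
  refine (integral_map (measurable_pi_apply k).aemeasurable ?_).symm
  rw [hπ.2 k]
  exact (hf k).aestronglyMeasurable

lemma pi_mem_plans [∀ k, IsProbabilityMeasure (μ k)] : Measure.pi μ ∈ plans μ :=
  ⟨inferInstance, fun k => (measurePreserving_eval μ k).map_eq⟩

lemma dualValue_add {f g : ∀ i, X i → ℝ} (hf : ∀ k, Integrable (f k) (μ k))
    (hg : ∀ k, Integrable (g k) (μ k)) :
    dualValue μ (fun k x => f k x + g k x) = dualValue μ f + dualValue μ g := by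
  unfold dualValue
  rw [← Finset.sum_add_distrib]
  exact Finset.sum_congr rfl fun k _ => integral_add (hf k) (hg k)

lemma dualValue_mul (r : ℝ) (f : ∀ i, X i → ℝ) :
    dualValue μ (fun k x => r * f k x) = r * dualValue μ f := by
  unfold dualValue
  rw [Finset.mul_sum]
  exact Finset.sum_congr rfl fun k _ => integral_const_mul r (f k)

lemma dualValue_mono {f g : ∀ i, X i → ℝ} (hf : ∀ k, Integrable (f k) (μ k))
    (hg : ∀ k, Integrable (g k) (μ k)) (h : ∀ k x, f k x ≤ g k x) :
    dualValue μ f ≤ dualValue μ g :=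
  Finset.sum_le_sum fun k _ => integral_mono (hf k) (hg k) (h k)

lemma motValue_le_primalCost (hc0 : ∀ x, 0 ≤ c x) {π : Measure (∀ i, X i)} (hπ : π ∈ plans μ) :
    motValue c μ ≤ primalCost c π := by
  refine csInf_le ⟨0, ?_⟩ ⟨π, hπ, rfl⟩
  rintro _ ⟨π, -, rfl⟩
  exact integral_nonneg hc0

lemma dualValue_add_const [∀ k, IsProbabilityMeasure (μ k)] {f : ∀ i, X i → ℝ}
    (hf : ∀ k, Integrable (f k) (μ k)) {a : Fin K → ℝ} (ha : ∑ k, a k = 0) :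
    dualValue μ (fun k x => f k x + a k) = dualValue μ f := by
  rw [dualValue_add hf fun k => integrable_const (a k)]
  simp [dualValue, ha]

variable [∀ k, MetricSpace (X k)] [∀ k, CompactSpace (X k)] [∀ k, BorelSpace (X k)]

lemma borelSpace_pi : BorelSpace (∀ i, X i) := by
  have : ∀ k, SecondCountableTopology (X k) := fun k =>
    UniformSpace.secondCountable_of_separable (X k)
  infer_instance

lemma integrable_of_continuous {Y : Type*} [TopologicalSpace Y] [CompactSpace Y]
    [MeasurableSpace Y] [OpensMeasurableSpace Y] {ν : Measure Y}
    [IsFiniteMeasure ν] {h : Y → ℝ} (hh : Continuous h) : Integrable h ν :=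
  hh.integrable_of_hasCompactSupport (HasCompactSupport.of_compactSpace h)

lemma dualValue_le_primalCost (hc : Continuous c) {π : Measure (∀ i, X i)} (hπ : π ∈ plans μ)
    {f : ∀ i, X i → ℝ} (hf : f ∈ admissible c μ) : dualValue μ f ≤ primalCost c π := by
  have := borelSpace_pi (X := X)
  have := hπ.1
  obtain ⟨hi, he⟩ := integrable_sum_and_integral_eq hπ fun k => (hf.1 k).2
  rw [← he]
  exact integral_mono hi (integrable_of_continuous hc) hf.2

lemma dualValue_le_motValue [∀ k, IsProbabilityMeasure (μ k)] (hc : Continuous c)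
    {f : ∀ i, X i → ℝ} (hf : f ∈ admissible c μ) : dualValue μ f ≤ motValue c μ := by
  refine le_csInf ⟨_, _, pi_mem_plans, rfl⟩ ?_
  rintro _ ⟨π, hπ, rfl⟩
  exact dualValue_le_primalCost hc hπ hf

/-- Every conjugate family is admissible. -/
lemma cConjFamilies_subset_admissible [∀ k, IsProbabilityMeasure (μ k)] (hK : 1 ≤ K)
    (hc : Continuous c) : cConjFamilies c ⊆ admissible c μ := fun _ hf =>
  ⟨fun k => have h := continuous_of_conjugate hc (hf k)
    ⟨h.measurable, integrable_of_continuous h⟩, sum_le_of_conjugate (hf ⟨0, hK⟩)⟩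

open scoped BoundedContinuousFunction

/-- The continuous feasible families contain a conjugate family with maximal dual value. -/
lemma exists_cConjFamilies_max [∀ k, IsProbabilityMeasure (μ k)] (hK : 1 ≤ K)
    (hc : Continuous c) (hc0 : ∀ x, 0 ≤ c x) :
    ∃ f ∈ cConjFamilies c, ∀ g : ∀ i, X i → ℝ, (∀ k, Continuous (g k)) →
      (∀ x : ∀ i, X i, ∑ i, g i (x i) ≤ c x) → dualValue μ g ≤ dualValue μ f := by
  have hne : ∀ k, Nonempty (X k) := fun k => (μ k).nonempty_of_neZero
  obtain ⟨M, hM⟩ := exists_cost_bound hc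
  -- bounded functions with the moduli of continuity of the cost
  let A : ∀ k, Set (X k →ᵇ ℝ) := fun k => {u | (∀ x, u x ∈ Set.Icc (-(2 * M)) (2 * M)) ∧
    ∀ x x' B, (∀ y : ∀ i, X i,
      c (Function.update y k x) ≤ c (Function.update y k x') + B) → u x ≤ u x' + B}
  have hev : ∀ k (x : X k), Continuous fun u : X k →ᵇ ℝ => u x := fun _ x =>
    continuous_eval_const x
  have hA : ∀ k, IsCompact (A k) := fun k => by
    refine BoundedContinuousFunction.arzela_ascoli₂ (Set.Icc (-(2 * M)) (2 * M)) isCompact_Icc _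
      ?_ (fun f x hf => hf.1 x) ?_
    · simp only [A, Set.ofPred_and, Set.ofPred_forall]
      exact (isClosed_iInter fun x => isClosed_Icc.preimage (hev k x)).inter <|
        isClosed_iInter fun x => isClosed_iInter fun x' => isClosed_iInter fun B =>
          isClosed_iInter fun _ => isClosed_le (hev k x) ((hev k x').add continuous_const)
    · refine fun x => Metric.equicontinuousAt_iff.2 fun ε hε => ?_
      obtain ⟨δ, hδ, hm⟩ := exists_uniform_modulus hc (half_pos hε)
      refine ⟨δ, hδ, fun x' hx' u => ?_⟩
      have h₁ := u.2.2 x' x _ (hm k x' x hx')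
      have h₂ := u.2.2 x x' _ (hm k x x' (by rwa [dist_comm]))
      rw [Real.dist_eq, abs_lt]
      constructor <;> linarith
  -- Conjugacy is not required in `C`: normalized conjugate families lie in it (`hmem`), and its
  -- maximizer is conjugated afterwards (`hbelow`).
  let C : Set (∀ k, X k →ᵇ ℝ) := Set.univ.pi A ∩ {u | ∀ x : ∀ i, X i, ∑ k, u k (x k) ≤ c x}
  have hC : IsCompact C := by
    refine (isCompact_univ_pi hA).inter_right ?_
    simp only [Set.ofPred_forall]
    exact isClosed_iInter fun x => isClosed_le
      (continuous_finsetSum _ fun k _ => (hev k (x k)).comp (continuous_apply k)) continuous_const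
  have hmem : ∀ g ∈ cConjFamilies c, ∃ u ∈ C, dualValue μ (fun k => u k) = dualValue μ g := by
    intro g hg
    have hgc : ∀ k, Continuous (g k) := fun k => continuous_of_conjugate hc (hg k)
    obtain ⟨a, ha, hga⟩ := exists_normalization hK hc0 hM hg
    refine ⟨fun k => BoundedContinuousFunction.mkOfCompact
      ⟨fun x => g k x + a k, (hgc k).add continuous_const⟩, ⟨fun k _ => ⟨fun x => ?_, ?_⟩, ?_⟩, ?_⟩
    · exact abs_le.1 (hga k x)
    · intro x x' B hB
      have := conjugate_le_add (hg k) hB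
      simp only [BoundedContinuousFunction.mkOfCompact_apply, ContinuousMap.coe_mk]
      linarith
    · intro x
      simpa [Finset.sum_add_distrib, ha] using sum_le_of_conjugate (hg ⟨0, hK⟩) x
    · exact dualValue_add_const (fun k => integrable_of_continuous (hgc k)) ha
  have hbelow : ∀ g : ∀ i, X i → ℝ, (∀ k, Continuous (g k)) →
      (∀ x : ∀ i, X i, ∑ i, g i (x i) ≤ c x) →
      ∃ f ∈ cConjFamilies c, dualValue μ g ≤ dualValue μ f := by
    intro g hg hgc
    obtain ⟨f, hf, hgf⟩ := exists_cConjFamilies_ge hc hg hgc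
    exact ⟨f, hf, dualValue_mono (fun k => integrable_of_continuous (hg k))
      (fun k => integrable_of_continuous (continuous_of_conjugate hc (hf k))) hgf⟩
  have hJ : Continuous fun u : ∀ k, X k →ᵇ ℝ => dualValue μ (fun k => u k) := by
    refine continuous_finsetSum _ fun k _ => ?_
    have : LipschitzWith 1 fun v : X k →ᵇ ℝ => ∫ x, v x ∂(μ k) := by
      refine LipschitzWith.of_dist_le_mul fun v w => ?_
      rw [dist_eq_norm, ← integral_sub (integrable_of_continuous v.continuous)
        (integrable_of_continuous w.continuous)]
      refine (norm_integral_le_of_norm_le_const (C := dist v w) ?_).trans (by simp)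
      exact .of_forall fun x => by
        rw [← dist_eq_norm]; exact BoundedContinuousFunction.dist_coe_le_dist x
    exact this.continuous.comp (continuous_apply k)
  obtain ⟨f₀, hf₀, -⟩ := hbelow (fun _ _ => 0) (fun _ => continuous_const) (by simpa using hc0)
  obtain ⟨u₀, hu₀, -⟩ := hmem f₀ hf₀
  obtain ⟨u, hu, hmax⟩ := hC.exists_isMaxOn ⟨u₀, hu₀⟩ hJ.continuousOn
  obtain ⟨f, hf, huf⟩ := hbelow (fun k => u k) (fun k => (u k).continuous) hu.2
  refine ⟨f, hf, fun g hg hgc => ?_⟩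
  obtain ⟨g', hg', hgg'⟩ := hbelow g hg hgc
  obtain ⟨v, hv, hvg⟩ := hmem g' hg'
  exact (hgg'.trans hvg.ge).trans ((hmax hv).trans huf)

end Measure

/-! ### Absence of a duality gap, by Hahn–Banach and Riesz. -/

section Duality

variable {K : ℕ} {X : Fin K → Type*} [∀ k, MeasurableSpace (X k)] [∀ k, MetricSpace (X k)]
  (μ : ∀ k, Measure (X k))

/-- The continuous families whose sum dominates `h`. -/
def dominating (h : C(∀ i, X i, ℝ)) : Set (∀ i, X i → ℝ) :=
  {f | (∀ k, Continuous (f k)) ∧ ∀ x : ∀ i, X i, h x ≤ ∑ k, f k (x k)}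

/-- The least total integral of a continuous family whose sum dominates `h`. -/
noncomputable def superhedge (h : C(∀ i, X i, ℝ)) : ℝ :=
  sInf (dualValue μ '' dominating h)

variable {μ} [∀ k, CompactSpace (X k)] [∀ k, BorelSpace (X k)] [∀ k, IsProbabilityMeasure (μ k)]

omit [∀ k, MeasurableSpace (X k)] [∀ k, BorelSpace (X k)] in
lemma dominating_nonempty (hK : 1 ≤ K) (h : C(∀ i, X i, ℝ)) : (dominating h).Nonempty := by
  refine ⟨fun _ _ => ‖h‖, fun _ => continuous_const, fun x => ?_⟩
  have h₁ : h x ≤ ‖h‖ := (le_abs_self _).trans (h.norm_coe_le_norm x)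
  have hK' : (1 : ℝ) ≤ K := by exact_mod_cast hK
  simp only [Finset.sum_const, Finset.card_univ, Fintype.card_fin, nsmul_eq_mul]
  nlinarith [norm_nonneg h]

/-- The product measure is a plan, so the infimum in `superhedge` is over a set bounded below. -/
lemma integral_le_of_mem_dominating {h : C(∀ i, X i, ℝ)} {f : ∀ i, X i → ℝ}
    (hf : f ∈ dominating h) : ∫ x, h x ∂(Measure.pi μ) ≤ dualValue μ f := by
  have := borelSpace_pi (X := X)
  obtain ⟨hi, he⟩ := integrable_sum_and_integral_eq (pi_mem_plans (μ := μ))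
    fun k => integrable_of_continuous (hf.1 k)
  rw [← he]
  exact integral_mono (integrable_of_continuous h.continuous) hi hf.2

lemma superhedge_le {h : C(∀ i, X i, ℝ)} {f : ∀ i, X i → ℝ} (hf : f ∈ dominating h) :
    superhedge μ h ≤ dualValue μ f := by
  refine csInf_le ⟨∫ x, h x ∂(Measure.pi μ), ?_⟩ ⟨f, hf, rfl⟩
  rintro _ ⟨g, hg, rfl⟩
  exact integral_le_of_mem_dominating hg

omit [∀ k, BorelSpace (X k)] [∀ k, IsProbabilityMeasure (μ k)] in
lemma le_superhedge (hK : 1 ≤ K) {h : C(∀ i, X i, ℝ)} {b : ℝ}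
    (hb : ∀ f ∈ dominating h, b ≤ dualValue μ f) : b ≤ superhedge μ h := by
  refine le_csInf ((dominating_nonempty hK h).image _) ?_
  rintro _ ⟨f, hf, rfl⟩
  exact hb f hf

lemma superhedge_zero (hK : 1 ≤ K) : superhedge μ 0 = 0 := by
  refine le_antisymm ?_ (le_superhedge hK fun f hf => ?_)
  · have : (fun _ _ => 0) ∈ dominating (0 : C(∀ i, X i, ℝ)) :=
      ⟨fun _ => continuous_const, by simp⟩
    simpa [dualValue] using superhedge_le (μ := μ) this
  · simpa using integral_le_of_mem_dominating (μ := μ) hf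

lemma superhedge_add (hK : 1 ≤ K) (h₁ h₂ : C(∀ i, X i, ℝ)) :
    superhedge μ (h₁ + h₂) ≤ superhedge μ h₁ + superhedge μ h₂ := by
  suffices superhedge μ (h₁ + h₂) - superhedge μ h₂ ≤ superhedge μ h₁ by linarith
  refine le_superhedge hK fun f hf => ?_
  suffices superhedge μ (h₁ + h₂) - dualValue μ f ≤ superhedge μ h₂ by linarith
  refine le_superhedge hK fun g hg => ?_
  have hfg : (fun k x => f k x + g k x) ∈ dominating (h₁ + h₂) :=
    ⟨fun k => (hf.1 k).add (hg.1 k), fun x => by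
      simpa [Finset.sum_add_distrib] using add_le_add (hf.2 x) (hg.2 x)⟩
  have := superhedge_le (μ := μ) hfg
  rw [dualValue_add (fun k => integrable_of_continuous (hf.1 k))
    fun k => integrable_of_continuous (hg.1 k)] at this
  linarith

lemma superhedge_smul_le (hK : 1 ≤ K) {r : ℝ} (hr : 0 < r) (h : C(∀ i, X i, ℝ)) :
    superhedge μ (r • h) ≤ r * superhedge μ h := by
  rw [← div_le_iff₀' hr]
  refine le_superhedge hK fun f hf => ?_
  rw [div_le_iff₀' hr, ← dualValue_mul]
  refine superhedge_le ⟨fun k => continuous_const.mul (hf.1 k), fun x => ?_⟩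
  rw [← Finset.mul_sum]
  simpa using mul_le_mul_of_nonneg_left (hf.2 x) hr.le

lemma superhedge_smul (hK : 1 ≤ K) {r : ℝ} (hr : 0 < r) (h : C(∀ i, X i, ℝ)) :
    superhedge μ (r • h) = r * superhedge μ h := by
  refine le_antisymm (superhedge_smul_le hK hr h) ?_
  have := superhedge_smul_le (μ := μ) hK (inv_pos.2 hr) (r • h)
  rwa [inv_smul_smul₀ hr.ne', ← div_eq_inv_mul, le_div_iff₀' hr] at this

/-- A linear functional dominated by `superhedge` and touching it at a given function. -/
lemma exists_linear_le_superhedge (hK : 1 ≤ K) (h₀ : C(∀ i, X i, ℝ)) :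
    ∃ L : C(∀ i, X i, ℝ) →ₗ[ℝ] ℝ, L h₀ = superhedge μ h₀ ∧ ∀ h, L h ≤ superhedge μ h := by
  have H : ∀ r : ℝ, r • h₀ = 0 → r • superhedge μ h₀ = 0 := fun r hr => by
    rcases smul_eq_zero.1 hr with rfl | rfl
    · simp
    · rw [superhedge_zero hK, smul_zero]
  let l := LinearPMap.mkSpanSingleton' (σ := RingHom.id ℝ) h₀ (superhedge μ h₀) H
  have hl : ∀ x : l.domain, l x ≤ superhedge μ x := by
    rintro ⟨x, hx⟩
    obtain ⟨r, rfl⟩ := Submodule.mem_span_singleton.1 hx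
    rw [show l _ = _ from LinearPMap.mkSpanSingleton'_apply _ _ _ _ _]
    simp only [RingHom.id_apply, smul_eq_mul]
    rcases lt_trichotomy r 0 with hr | rfl | hr
    -- For `r < 0`, subadditivity gives `0 = p 0 ≤ p (r • h₀) + (-r) * p h₀`.
    · have h₁ := superhedge_add (μ := μ) hK (r • h₀) ((-r) • h₀)
      rw [← add_smul, add_neg_cancel, zero_smul, superhedge_zero hK,
        superhedge_smul hK (neg_pos.2 hr)] at h₁
      linarith
    · simp [superhedge_zero hK]
    · exact (superhedge_smul hK hr h₀).ge
  obtain ⟨L, hL, hLs⟩ := exists_extension_of_le_sublinear l (superhedge μ)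
    (fun r hr h => superhedge_smul hK hr h) (superhedge_add hK) hl
  refine ⟨L, ?_, hLs⟩
  have hmem : h₀ ∈ Submodule.span ℝ {h₀} := Submodule.mem_span_singleton_self h₀
  exact (hL ⟨h₀, hmem⟩).trans (LinearPMap.mkSpanSingleton'_apply_self _ _ _ _)

/-- A linear functional dominated by `superhedge` is integration against a plan. -/
lemma exists_plan_of_le_superhedge (hK : 1 ≤ K) {L : C(∀ i, X i, ℝ) →ₗ[ℝ] ℝ}
    (hL : ∀ h, L h ≤ superhedge μ h) : ∃ π ∈ plans μ, ∀ h, ∫ x, h x ∂π = L h := by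
  have := borelSpace_pi (X := X)
  have hpos : ∀ h : C(∀ i, X i, ℝ), 0 ≤ h → 0 ≤ L h := fun h hh => by
    have h₁ : (fun _ _ => 0) ∈ dominating (-h) :=
      ⟨fun _ => continuous_const, fun x => by simpa using hh x⟩
    have h₂ := (hL (-h)).trans (superhedge_le (μ := μ) h₁)
    simp only [map_neg, dualValue, integral_zero, Finset.sum_const_zero] at h₂
    linarith
  let Λ : CompactlySupportedContinuousMap (∀ i, X i) ℝ →ₚ[ℝ] ℝ := PositiveLinearMap.mk₀
    { toFun := fun h => L h.toContinuousMap
      map_add' := fun h₁ h₂ => L.map_add h₁.toContinuousMap h₂.toContinuousMap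
      map_smul' := fun r h => L.map_smul r h.toContinuousMap }
    fun h hh => hpos h.toContinuousMap hh
  set π := RealRMK.rieszMeasure Λ
  have hint : ∀ h : C(∀ i, X i, ℝ), ∫ x, h x ∂π = L h := fun h =>
    RealRMK.integral_rieszMeasure Λ ⟨h, HasCompactSupport.of_compactSpace h⟩
  have hfin : IsFiniteMeasure π := by
    have : π.Regular := RealRMK.regular_rieszMeasure Λ
    infer_instance
  have hmap : ∀ k, π.map (fun x => x k) = μ k := fun k => by
    have : IsFiniteMeasure (π.map fun x => x k) := inferInstance
    refine ext_of_forall_integral_eq_of_IsFiniteMeasure fun u => ?_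
    rw [integral_map (measurable_pi_apply k).aemeasurable
      u.continuous.aestronglyMeasurable]
    have key : ∀ v : C(X k, ℝ), L (v.comp (ContinuousMap.eval k)) ≤ ∫ x, v x ∂(μ k) := by
      intro v
      -- The family with `v` in coordinate `k` and zero elsewhere; using it for both `v` and `-v`
      -- turns domination into equality of marginals.
      have hv : (fun i => if h : i = k then fun x => v (h ▸ x) else fun _ => 0) ∈
          dominating (v.comp (ContinuousMap.eval k)) := by
        refine ⟨fun i => ?_, fun x => ?_⟩
        · by_cases h : i = k
          · subst h; simpa using v.continuous
          · simpa [h] using continuous_const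
        · rw [Finset.sum_eq_single k] <;> simp +contextual
      refine (hL _).trans ((superhedge_le hv).trans_eq ?_)
      unfold dualValue
      rw [Finset.sum_eq_single k] <;> simp +contextual
    let v : C(X k, ℝ) := ⟨u, u.continuous⟩
    have h₁ := key v
    have h₂ := key (-v)
    have h₃ : (-v).comp (ContinuousMap.eval k) =
        -(v.comp (ContinuousMap.eval k) : C(∀ i, X i, ℝ)) := rfl
    rw [h₃, map_neg] at h₂
    simp only [ContinuousMap.neg_apply, integral_neg] at h₂
    exact (hint (v.comp (ContinuousMap.eval k))).trans (le_antisymm h₁ (neg_le_neg_iff.1 h₂))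
  refine ⟨π, ⟨⟨?_⟩, hmap⟩, hint⟩
  -- The total mass is read off from one marginal, which exists because `K ≥ 1`.
  have : π.map (fun x => x ⟨0, hK⟩) Set.univ = 1 := by rw [hmap]; simp
  rwa [Measure.map_apply (measurable_pi_apply _) .univ] at this

end Duality

end MOT

open MOT

theorem theorem4p2 {K : ℕ} (hK : 1 ≤ K) {X : Fin K → Type*}
    [∀ k, MetricSpace (X k)] [∀ k, CompactSpace (X k)]
    [∀ k, MeasurableSpace (X k)] [∀ k, BorelSpace (X k)]
    (μ : ∀ k, Measure (X k)) [∀ k, IsProbabilityMeasure (μ k)]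
    (c : (∀ k, X k) → ℝ) (hc : Continuous c) (hc0 : ∀ x, 0 ≤ c x) :
    (∃ f ∈ MOT.dualSolutions c μ, f ∈ MOT.cConjFamilies c ∧ ∀ k, f k ∈ MOT.cConj c k) ∧
    IsGreatest (MOT.dualValue μ '' MOT.admissible c μ) (MOT.motValue c μ) ∧
    IsGreatest (MOT.dualValue μ '' (MOT.admissible c μ ∩ MOT.cConjProd c)) (MOT.motValue c μ) ∧
    MOT.cConjFamilies c ⊆ MOT.admissible c μ ∧
    IsGreatest (MOT.dualValue μ '' MOT.cConjFamilies c) (MOT.motValue c μ) := by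
  have hsub := cConjFamilies_subset_admissible (μ := μ) hK hc
  have hweak : ∀ g ∈ admissible c μ, dualValue μ g ≤ motValue c μ :=
    fun g hg => dualValue_le_motValue hc hg
  obtain ⟨f, hf, hmax⟩ := exists_cConjFamilies_max (μ := μ) hK hc hc0
  obtain ⟨L, hL₀, hL⟩ := exists_linear_le_superhedge (μ := μ) hK (-⟨c, hc⟩)
  obtain ⟨π, hπ, hint⟩ := exists_plan_of_le_superhedge hK hL
  have hcost : primalCost c π ≤ dualValue μ f := by
    have h₁ : primalCost c π = L ⟨c, hc⟩ := hint ⟨c, hc⟩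
    -- Negation turns families dominating `-c` into continuous families feasible for `c`.
    have h₂ : -dualValue μ f ≤ superhedge μ (-⟨c, hc⟩) := le_superhedge hK fun g hg => by
      have := hmax (fun k x => -1 * g k x) (fun k => continuous_const.mul (hg.1 k)) fun x => by
        have : -c x ≤ _ := hg.2 x
        rw [← Finset.mul_sum]
        linarith
      rw [dualValue_mul] at this
      linarith
    rw [map_neg] at hL₀
    linarith
  have heq : dualValue μ f = motValue c μ :=
    le_antisymm (hweak f (hsub hf)) ((motValue_le_primalCost hc0 hπ).trans hcost)
  have hconj : ∀ k, f k ∈ cConj c k := fun k => ⟨f, hf k⟩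
  refine ⟨⟨f, ⟨hsub hf, fun g hg => (hweak g hg).trans_eq heq.symm⟩, hf, hconj⟩,
    ⟨⟨f, hsub hf, heq⟩, ?_⟩, ⟨⟨f, ⟨hsub hf, hconj⟩, heq⟩, ?_⟩, hsub, ⟨⟨f, hf, heq⟩, ?_⟩⟩
  · rintro _ ⟨g, hg, rfl⟩; exact hweak g hg
  · rintro _ ⟨g, hg, rfl⟩; exact hweak g hg.1
  · rintro _ ⟨g, hg, rfl⟩; exact hweak g (hsub hg)
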